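/- An arrangement $\mathcal W=(W_1,\dots,W_k)$ of $d$-dimensional linear subspaces (not necessarily distinct) of a finite-dimensional complex vector space $V$ is *totally symmetric* if for every permutation $\sigma$ of $\{1,\dots,k\}$ there is $P_\sigma\in \mathrm{GL}(V)$ with $P_\sigma W_i=W_{\sigma(i)}$ for all $i$. It is *degenerate* if all the $W_i$ are equal to one fixed subspace (in particular if $k\le 1$), and *nondegenerate* otherwise. Arrangements $(W_i)_{i=1}^k$ in $V$ and $(W_i')_{i=1}^k$ in $V'$ are *isomorphic* if there is a linear isomorphism $T:V\to V'$ with $T(W_i)=W_i'$ for all $i$. The *dual arrangement* of $(W_i)$ consists of the subspaces $W_i^*=\{\alpha\in V^*: \alpha|_{W_i}=0\}$ of $V^*$. The *simplex arrangement* $\mathcal S_n$ is the arrangement of the $n+1$ lines in $\mathbb C^{n+1}/\langle e_1+\dots+e_{n+1}\rangle\cong\mathbb C^n$ spanned by the images of $e_1,\dots,e_{n+1}$, and $\mathcal S_n^*$ is its dual arrangement. The *$\tilde\Sigma_5$ arrangement* (the system of subrepresentations in the $4$-dimensional basic spin representation of the double cover $\tilde\Sigma_5$ of the symmetric group $\Sigma_5$,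 generated by a $2$-dimensional basic spin subrepresentation of the preimage of the stabilizer of the letter $1$) is the arrangement of the five $2$-planes in $\mathbb C^4$ that are the column spaces of the $4\times 2$ matrices, written in $2\times2$ blocks, $$\binom{I}{0},\quad \binom{0}{I},\quad \binom{I}{I},\quad \binom{A_4}{I},\quad \binom{A_5}{I},$$ $$A_4=\begin{pmatrix}\zeta&0\\0&\zeta^{-1}\end{pmatrix},\qquad A_5=\begin{pmatrix}\frac{3+i\sqrt3}{6}&\frac{\sqrt2\,i}{\sqrt3}\\ \frac{\sqrt2\,i}{\sqrt3}&\frac{3-i\sqrt3}{6}\end{pmatrix},\qquad \zeta=\frac{1+i\sqrt3}{2}.$$ **Theorem.** Let $\mathcal W=(W_1,\dots,W_k)$ be a nondegenerate totally symmetric arrangement of subspaces of $\mathbb C^n$. Then $k\le n+1$. Moreover, if $k=n+1$, then $\mathcal W$ is isomorphic to the simplex arrangement $\mathcal S_n$, or to its dual $\mathcal S_n^*$, or else $k=5$ and $\mathcal W$ is isomorphic to the $\tilde\Sigma_5$ arrangement. -/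

import Mathlib

noncomputable section

/-- An arrangement `W` of subspaces of `V`, indexed by `ι` (not necessarily distinct), is totally
symmetric if its members all have the same dimension `d` and every permutation `σ` of the indices
is realized by some `P ∈ GL(V)`, in the sense that `P (W i) = W (σ i)` for all `i`. -/
def IsTotallySymmetricArrangement {ι V : Type*} [AddCommGroup V] [Module ℂ V]
    (W : ι → Submodule ℂ V) : Prop :=
  (∃ d : ℕ, ∀ i, Module.finrank ℂ (W i) = d) ∧
    ∀ σ : Equiv.Perm ι, ∃ P : V ≃ₗ[ℂ] V, ∀ i, (W i).map (P : V →ₗ[ℂ] V) = W (σ i)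

/-- An arrangement is degenerate if all its members are one and the same subspace
(in particular, arrangements with at most one member are degenerate). -/
def IsDegenerateArrangement {ι V : Type*} [AddCommGroup V] [Module ℂ V]
    (W : ι → Submodule ℂ V) : Prop :=
  ∃ U : Submodule ℂ V, ∀ i, W i = U

/-- Two arrangements with the same index set are isomorphic if some linear isomorphism of the
ambient spaces carries each `W i` isomorphically onto `W' i`. -/
def ArrangementIso {ι V V' : Type*} [AddCommGroup V] [Module ℂ V] [AddCommGroup V'] [Module ℂ V']
    (W : ι → Submodule ℂ V) (W' : ι → Submodule ℂ V') : Prop :=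
  ∃ T : V ≃ₗ[ℂ] V', ∀ i, (W i).map (T : V →ₗ[ℂ] V') = W' i

/-- The dual arrangement in `V*`, consisting of the annihilators
`{α ∈ V* | α vanishes on W i}`. -/
def dualArrangement {ι V : Type*} [AddCommGroup V] [Module ℂ V]
    (W : ι → Submodule ℂ V) : ι → Submodule ℂ (Module.Dual ℂ V) :=
  fun i => (W i).dualAnnihilator

/-- The line in `ℂ^(n+1)` spanned by the all-ones vector `γ = e₁ + ⋯ + eₙ₊₁`. -/
def gammaLine (n : ℕ) : Submodule ℂ (Fin (n + 1) → ℂ) :=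
  Submodule.span ℂ {fun _ => 1}

/-- The underlying `n`-dimensional space `ℂ^(n+1) / ⟨γ⟩` of the standard representation of the
symmetric group on `n + 1` letters. -/
abbrev StdRep (n : ℕ) : Type := (Fin (n + 1) → ℂ) ⧸ gammaLine n

/-- The simplex arrangement: the `n + 1` lines in `ℂ^(n+1) / ⟨γ⟩` spanned by the images of the
standard basis vectors. -/
def simplexArrangement (n : ℕ) : Fin (n + 1) → Submodule ℂ (StdRep n) :=
  fun i => Submodule.span ℂ {(gammaLine n).mkQ (Pi.single i 1)}

/-- The primitive sixth root of unity `ζ = e^(iπ/3) = (1 + i√3)/2`. -/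
def zeta6 : ℂ := (1 + Complex.I * (Real.sqrt 3 : ℂ)) / 2

/-- The `4 × 2` matrices whose column spaces form the `Σ̃₅` arrangement. In `2 × 2` blocks, they are
`(I; 0)`, `(0; I)`, `(I; I)`, `(A₄; I)`, `(A₅; I)` with `A₄ = diag(ζ, ζ⁻¹)`. They are in the
coordinates on the `4`-dimensional basic spin representation of `Σ̃₅` in which the first of them
spans a subrepresentation for the preimage of the stabilizer of the letter `1`. -/
def tildeSigma5Matrix : Fin 5 → Matrix (Fin 4) (Fin 2) ℂ :=
  ![!![1, 0;
       0, 1;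
       0, 0;
       0, 0],
    !![0, 0;
       0, 0;
       1, 0;
       0, 1],
    !![1, 0;
       0, 1;
       1, 0;
       0, 1],
    !![zeta6, 0;
       0, zeta6⁻¹;
       1, 0;
       0, 1],
    !![(3 + Complex.I * (Real.sqrt 3 : ℂ)) / 6, (Real.sqrt 2 : ℂ) * Complex.I / (Real.sqrt 3 : ℂ);
       (Real.sqrt 2 : ℂ) * Complex.I / (Real.sqrt 3 : ℂ), (3 - Complex.I * (Real.sqrt 3 : ℂ)) / 6;
       1, 0;
       0, 1]]

/-- The `Σ̃₅` arrangement of five `2`-planes in `ℂ⁴`. -/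
def tildeSigma5Arrangement : Fin 5 → Submodule ℂ (Fin 4 → ℂ) :=
  fun i => LinearMap.range (tildeSigma5Matrix i).mulVecLin

end

/-!
The proof is an induction on `dim V`, in which `V` and the index set are arbitrary.

Suppose there are at least `dim V + 1` members. Intersecting the others with a fixed member `W a`
gives a symmetric arrangement in `W a` with one subspace fewer. If it is nondegenerate, the bound in
dimension `dim W a` forces the members to be hyperplanes. If it is degenerate, all pairwise
intersections coincide, and dividing by the common intersection shows that it is zero
(`hyperplane_or_inf_eq_bot`). Applying the same to the dual arrangement leaves three cases: lines,
hyperplanes, or pairwise complementary subspaces (`lines_or_hyperplanes_or_isCompl`).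

Lines in number `dim V + 1` span `V`, so their spanning vectors satisfy one linear relation, whose
support is invariant under all permutations; scaling it to `∑ v i = 0` identifies the arrangement
with the simplex arrangement (`arrangementIso_simplexArrangement`). Hyperplanes are dual to this.

In the complementary case `dim V = 2d`, and one member may be placed at `ℂᵈ × 0`, two others at the
graphs of `0` and `1`, and the remaining ones at graphs of matrices `A i` with invertible
differences. Symmetries fixing the first member act by affine substitutions
(`IsGraphChart.exists_affine`): permutations of the remaining `A i` are simultaneous conjugations,
and moreover `A i` is conjugate to `1 - A i` and to `(A i)⁻¹`, while `(A i)⁻¹ * A j` is conjugate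
to `A j`.
* The eigenspaces of the `A i` for a fixed eigenvalue form a nondegenerate symmetric arrangement
  in `ℂᵈ` with three members fewer than the original one. Its size is at most `d + 1` by induction,
  so `d ≤ 3`.
* If `d` is odd, `A i` has the eigenvalues `1/2`, `2`, `-1`. This excludes a fourth member for
  `d = 1`. For `d = 3` it makes the conjugations commuting with `A i` commute with each other,
  which is absurd, as they realize all permutations of three further indices.
* If `d = 2`, then `tr (A i) = det (A i) = 1` and `tr ((A i)⁻¹ * A j) = 1`. With `A i` in diagonal
  form this determines `A j` up to conjugation by a diagonal matrix, giving the `Σ̃₅` arrangement,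
  and leaves no room for a sixth member.
-/

noncomputable section

open Module Matrix

/-! ### Constructions on totally symmetric arrangements -/

/-- A linear equivalence carries `S` onto `S'` exactly when it detects membership in them. -/
theorem Submodule.map_linearEquiv_eq_iff {V V' : Type*} [AddCommGroup V] [Module ℂ V]
    [AddCommGroup V'] [Module ℂ V'] (P : V ≃ₗ[ℂ] V') (S : Submodule ℂ V) (S' : Submodule ℂ V') :
    S.map (P : V →ₗ[ℂ] V') = S' ↔ ∀ x, P x ∈ S' ↔ x ∈ S := by
  rw [Submodule.map_equiv_eq_comap_symm]
  constructor
  · rintro rfl x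
    simp
  · intro h
    ext y
    rw [Submodule.mem_comap]
    simpa using (h (P.symm y)).symm

/-- The equality of dimensions is automatic, since transpositions move any member to any other. -/
theorem IsTotallySymmetricArrangement.of_forall_perm {ι V : Type*} [AddCommGroup V] [Module ℂ V]
    {W : ι → Submodule ℂ V}
    (h : ∀ σ : Equiv.Perm ι, ∃ P : V ≃ₗ[ℂ] V, ∀ i, (W i).map (P : V →ₗ[ℂ] V) = W (σ i)) :
    IsTotallySymmetricArrangement W := by
  classical
  refine ⟨?_, h⟩
  rcases isEmpty_or_nonempty ι with _ | ⟨⟨i₀⟩⟩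
  · exact ⟨0, fun i => isEmptyElim i⟩
  · refine ⟨finrank ℂ (W i₀), fun i => ?_⟩
    obtain ⟨P, hP⟩ := h (Equiv.swap i₀ i)
    have := LinearEquiv.finrank_map_eq P (W i₀)
    rw [hP i₀, Equiv.swap_apply_left] at this
    exact this

/-- Restriction of a symmetric arrangement to an invariant subspace `S`. -/
theorem isTotallySymmetricArrangement_comap_subtype {κ V : Type*} [AddCommGroup V] [Module ℂ V]
    (S : Submodule ℂ V) (W : κ → Submodule ℂ V)
    (h : ∀ σ : Equiv.Perm κ, ∃ P : V ≃ₗ[ℂ] V, S.map (P : V →ₗ[ℂ] V) = S ∧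
      ∀ i, (W i).map (P : V →ₗ[ℂ] V) = W (σ i)) :
    IsTotallySymmetricArrangement fun i => (W i).comap S.subtype := by
  refine .of_forall_perm fun σ => ?_
  obtain ⟨P, hS, hP⟩ := h σ
  refine ⟨P.ofSubmodules S S hS, fun i => ?_⟩
  rw [Submodule.map_linearEquiv_eq_iff]
  intro x
  simpa using (Submodule.map_linearEquiv_eq_iff _ _ _).1 (hP i) x

/-- The quotient of a symmetric arrangement by an invariant subspace `U`. -/
theorem isTotallySymmetricArrangement_map_mkQ {κ V : Type*} [AddCommGroup V] [Module ℂ V]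
    (U : Submodule ℂ V) (W : κ → Submodule ℂ V)
    (h : ∀ σ : Equiv.Perm κ, ∃ P : V ≃ₗ[ℂ] V, U.map (P : V →ₗ[ℂ] V) = U ∧
      ∀ i, (W i).map (P : V →ₗ[ℂ] V) = W (σ i)) :
    IsTotallySymmetricArrangement fun i => (W i).map U.mkQ := by
  refine .of_forall_perm fun σ => ?_
  obtain ⟨P, hU, hP⟩ := h σ
  refine ⟨Submodule.Quotient.equiv U U P hU, fun i => ?_⟩
  rw [← hP i, ← Submodule.map_comp, ← Submodule.map_comp]
  congr 1

theorem map_dualMap_symm_dualAnnihilator {V V' : Type*} [AddCommGroup V] [Module ℂ V]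
    [AddCommGroup V'] [Module ℂ V'] (P : V ≃ₗ[ℂ] V') {S : Submodule ℂ V} {S' : Submodule ℂ V'}
    (h : S.map (P : V →ₗ[ℂ] V') = S') :
    S.dualAnnihilator.map (P.symm.dualMap : Dual ℂ V →ₗ[ℂ] Dual ℂ V') = S'.dualAnnihilator := by
  subst h
  rw [Submodule.map_linearEquiv_eq_iff]
  intro f
  simpa [Submodule.mem_dualAnnihilator] using
    (P.symm.surjective.forall (p := fun w => w ∈ S → f w = 0)).symm

theorem IsTotallySymmetricArrangement.dual {ι V : Type*} [AddCommGroup V] [Module ℂ V]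
    {W : ι → Submodule ℂ V} (hW : IsTotallySymmetricArrangement W) :
    IsTotallySymmetricArrangement (dualArrangement W) := by
  refine .of_forall_perm fun σ => ?_
  obtain ⟨P, hP⟩ := hW.2 σ
  exact ⟨P.symm.dualMap, fun i => map_dualMap_symm_dualAnnihilator P (hP i)⟩

theorem isDegenerateArrangement_iff {ι V : Type*} [AddCommGroup V] [Module ℂ V]
    {W : ι → Submodule ℂ V} : IsDegenerateArrangement W ↔ ∀ i j, W i = W j := by
  constructor
  · rintro ⟨U, hU⟩ i j
    rw [hU, hU]
  · intro h
    rcases isEmpty_or_nonempty ι with _ | ⟨⟨i₀⟩⟩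
    · exact ⟨⊥, fun i => isEmptyElim i⟩
    · exact ⟨W i₀, fun i => h i i₀⟩

theorem not_isDegenerateArrangement_dual {ι V : Type*} [AddCommGroup V] [Module ℂ V]
    {W : ι → Submodule ℂ V} (hW : ¬ IsDegenerateArrangement W) :
    ¬ IsDegenerateArrangement (dualArrangement W) := by
  rw [isDegenerateArrangement_iff] at hW ⊢
  contrapose! hW
  intro i j
  exact Subspace.dualAnnihilator_inj.1 (hW i j)

theorem IsTotallySymmetricArrangement.finrank_eq {ι V : Type*} [AddCommGroup V] [Module ℂ V]
    {W : ι → Submodule ℂ V} (hW : IsTotallySymmetricArrangement W) (i j : ι) :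
    finrank ℂ (W i) = finrank ℂ (W j) := by
  obtain ⟨d, hd⟩ := hW.1
  rw [hd, hd]

/-- A symmetry realizing a permutation of the indices other than `a` can be chosen to fix `W a`. -/
theorem IsTotallySymmetricArrangement.exists_fixing {ι V : Type*} [AddCommGroup V] [Module ℂ V]
    {W : ι → Submodule ℂ V} (hW : IsTotallySymmetricArrangement W) (a : ι)
    (σ : Equiv.Perm {i // i ≠ a}) :
    ∃ P : V ≃ₗ[ℂ] V, (W a).map (P : V →ₗ[ℂ] V) = W a ∧
      ∀ i : {i // i ≠ a}, (W i).map (P : V →ₗ[ℂ] V) = W (σ i) := by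
  classical
  obtain ⟨P, hP⟩ := hW.2 (Equiv.Perm.ofSubtype σ)
  refine ⟨P, ?_, fun i => ?_⟩
  · rw [hP, Equiv.Perm.ofSubtype_apply_of_not_mem σ (by simp)]
  · rw [hP, Equiv.Perm.ofSubtype_apply_coe]

/-! ### Lines, hyperplanes, or complementary subspaces -/

/-- The bound on the size of nondegenerate symmetric arrangements, in dimensions below `n`. -/
def CardBoundBelow (n : ℕ) : Prop :=
  ∀ (ι V : Type) [Fintype ι] [AddCommGroup V] [Module ℂ V] [FiniteDimensional ℂ V]
    (W : ι → Submodule ℂ V), finrank ℂ V < n → IsTotallySymmetricArrangement W →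
    ¬ IsDegenerateArrangement W → Fintype.card ι ≤ finrank ℂ V + 1

theorem finrank_lt_of_not_isDegenerate {ι V : Type} [AddCommGroup V] [Module ℂ V]
    [FiniteDimensional ℂ V] {W : ι → Submodule ℂ V} (hW : IsTotallySymmetricArrangement W)
    (hnd : ¬ IsDegenerateArrangement W) (i : ι) : finrank ℂ (W i) < finrank ℂ V := by
  refine lt_of_le_of_ne (Submodule.finrank_le _) fun h => hnd ⟨⊤, fun j => ?_⟩
  exact Submodule.eq_top_of_finrank_eq ((hW.finrank_eq j i).trans h)

/-- An invariant subspace contained in every member of a large symmetric arrangement is zero, since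
otherwise the quotient by it would violate the bound in smaller dimension. -/
theorem eq_bot_of_invariant_le {ι V : Type} [Fintype ι] [AddCommGroup V] [Module ℂ V]
    [FiniteDimensional ℂ V] (ih : CardBoundBelow (finrank ℂ V)) {W : ι → Submodule ℂ V}
    (hnd : ¬ IsDegenerateArrangement W)
    (hcard : finrank ℂ V + 1 ≤ Fintype.card ι) (U : Submodule ℂ V) (hU : ∀ i, U ≤ W i)
    (h : ∀ σ : Equiv.Perm ι, ∃ P : V ≃ₗ[ℂ] V, U.map (P : V →ₗ[ℂ] V) = U ∧
      ∀ i, (W i).map (P : V →ₗ[ℂ] V) = W (σ i)) : U = ⊥ := by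
  by_contra hne
  have hpos : 0 < finrank ℂ U := Nat.pos_of_ne_zero fun h0 => hne (Submodule.finrank_eq_zero.1 h0)
  have hq := Submodule.finrank_quotient_add_finrank U
  have := ih ι (V ⧸ U) (fun i => (W i).map U.mkQ) (by omega)
    (isTotallySymmetricArrangement_map_mkQ U W h) (by
      rw [isDegenerateArrangement_iff] at hnd ⊢
      contrapose! hnd
      intro i j
      have hij := congrArg (Submodule.comap U.mkQ) (hnd i j)
      simpa [Submodule.comap_map_mkQ, hU] using hij)
  omega

/-- A large symmetric arrangement spans, since otherwise it would violate the bound in the span of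
its members. -/
theorem iSup_eq_top_of_card {ι V : Type} [Fintype ι] [AddCommGroup V] [Module ℂ V]
    [FiniteDimensional ℂ V] (ih : CardBoundBelow (finrank ℂ V)) {W : ι → Submodule ℂ V}
    (hW : IsTotallySymmetricArrangement W) (hnd : ¬ IsDegenerateArrangement W)
    (hcard : finrank ℂ V + 1 ≤ Fintype.card ι) : ⨆ i, W i = ⊤ := by
  by_contra hne
  have hlt := Submodule.finrank_lt hne
  have := ih ι (⨆ i, W i : Submodule ℂ V) (fun i => (W i).comap (⨆ i, W i).subtype) hlt
    (isTotallySymmetricArrangement_comap_subtype _ _ fun σ => by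
      obtain ⟨P, hP⟩ := hW.2 σ
      refine ⟨P, ?_, hP⟩
      rw [Submodule.map_iSup]
      simp_rw [hP]
      exact σ.iSup_comp (g := W)) (by
      rw [isDegenerateArrangement_iff] at hnd ⊢
      contrapose! hnd
      intro i j
      have hij := congrArg (Submodule.map (⨆ i, W i).subtype) (hnd i j)
      simpa [Submodule.map_comap_subtype, inf_eq_right.2 (le_iSup W _)] using hij)
  omega

/-- The members of a large symmetric arrangement either are hyperplanes or meet pairwise in zero:
intersecting with a fixed member gives an arrangement of one subspace fewer in that member. -/
theorem hyperplane_or_inf_eq_bot {ι V : Type} [Fintype ι] [AddCommGroup V] [Module ℂ V]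
    [FiniteDimensional ℂ V] (ih : CardBoundBelow (finrank ℂ V)) {W : ι → Submodule ℂ V}
    (hW : IsTotallySymmetricArrangement W) (hnd : ¬ IsDegenerateArrangement W)
    (hcard : finrank ℂ V + 1 ≤ Fintype.card ι) :
    (Fintype.card ι = finrank ℂ V + 1 ∧ ∀ i, finrank ℂ (W i) + 1 = finrank ℂ V) ∨
      ∀ i j, i ≠ j → W i ⊓ W j = ⊥ := by
  classical
  by_cases hdeg : ∀ a, IsDegenerateArrangement
      fun i : {i // i ≠ a} => (W i).comap (W a).subtype
  · right
    have key : ∀ a i j, i ≠ a → j ≠ a → W a ⊓ W i = W a ⊓ W j := by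
      intro a i j hi hj
      have hij := congrArg (Submodule.map (W a).subtype)
        (isDegenerateArrangement_iff.1 (hdeg a) ⟨i, hi⟩ ⟨j, hj⟩)
      simpa [Submodule.map_comap_subtype] using hij
    have all : ∀ i j k l, i ≠ j → k ≠ l → W i ⊓ W j = W k ⊓ W l := by
      intro i j k l hij hkl
      rcases eq_or_ne i l with rfl | hil
      · rw [inf_comm (W k)]
        exact key i j k hij.symm hkl
      · rw [key i j l hij.symm hil.symm, inf_comm, key l i k hil hkl, inf_comm]
    intro i j hij
    refine eq_bot_of_invariant_le ih hnd hcard _ (fun k => ?_) fun σ => ?_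
    · obtain ⟨l, hl⟩ : ∃ l, k ≠ l := by
        by_cases h : k = i
        · exact ⟨j, h ▸ hij⟩
        · exact ⟨i, h⟩
      rw [all i j k l hij hl]
      exact inf_le_left
    · obtain ⟨P, hP⟩ := hW.2 σ
      refine ⟨P, ?_, hP⟩
      rw [Submodule.map_inf _ P.injective, hP, hP]
      exact all _ _ _ _ (σ.injective.ne hij) hij
  · left
    push Not at hdeg
    obtain ⟨a, ha⟩ := hdeg
    have hlt := finrank_lt_of_not_isDegenerate hW hnd a
    have := ih {i // i ≠ a} (W a) _ hlt (isTotallySymmetricArrangement_comap_subtype (W a) _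
      fun σ => hW.exists_fixing a σ) ha
    have hc : Fintype.card {i // i ≠ a} = Fintype.card ι - 1 := by
      simp [Fintype.card_subtype_compl]
    refine ⟨by omega, fun i => ?_⟩
    rw [hW.finrank_eq i a]
    omega

/-- The preceding alternative, applied to an arrangement and to its dual. -/
theorem lines_or_hyperplanes_or_isCompl {ι V : Type} [Fintype ι] [AddCommGroup V] [Module ℂ V]
    [FiniteDimensional ℂ V] (ih : CardBoundBelow (finrank ℂ V)) {W : ι → Submodule ℂ V}
    (hW : IsTotallySymmetricArrangement W) (hnd : ¬ IsDegenerateArrangement W)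
    (hcard : finrank ℂ V + 1 ≤ Fintype.card ι) :
    (Fintype.card ι = finrank ℂ V + 1 ∧ ∀ i, finrank ℂ (W i) = 1) ∨
    (Fintype.card ι = finrank ℂ V + 1 ∧ ∀ i, finrank ℂ (W i) + 1 = finrank ℂ V) ∨
      ∀ i j, i ≠ j → IsCompl (W i) (W j) := by
  have hd : finrank ℂ (Dual ℂ V) = finrank ℂ V := Subspace.dual_finrank_eq
  rcases hyperplane_or_inf_eq_bot ih hW hnd hcard with h | h1
  · exact .inr (.inl h)
  rcases hyperplane_or_inf_eq_bot (V := Dual ℂ V) (by rwa [hd]) hW.dual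
    (not_isDegenerateArrangement_dual hnd) (by rwa [hd]) with h | h2
  · left
    rw [hd] at h
    refine ⟨h.1, fun i => ?_⟩
    have := Subspace.finrank_add_finrank_dualAnnihilator_eq (W i)
    have := h.2 i
    rw [dualArrangement] at this
    omega
  · right; right
    intro i j hij
    refine IsCompl.of_eq (h1 i j hij) ?_
    have := h2 i j hij
    rw [dualArrangement, dualArrangement, ← Submodule.dualAnnihilator_sup_eq] at this
    exact Subspace.dualAnnihilator_inj.1 (this.trans Submodule.dualAnnihilator_top.symm)

/-! ### Lines and hyperplanes: the simplex arrangement and its dual -/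

/-- Spanning lines `⟨v i⟩` of a symmetric arrangement can be normalized so that the `v i` sum to
zero: the linear relation between them is unique up to scale, so its support is invariant under all
permutations of the indices. -/
theorem arrangementIso_simplexArrangement {n : ℕ} {V : Type} [AddCommGroup V] [Module ℂ V]
    [FiniteDimensional ℂ V] (hn : finrank ℂ V = n) {W : Fin (n + 1) → Submodule ℂ V}
    (hW : IsTotallySymmetricArrangement W) (hline : ∀ i, finrank ℂ (W i) = 1)
    (htop : ⨆ i, W i = ⊤) : ArrangementIso W (simplexArrangement n) := by
  classical
  have hv : ∀ i, ∃ v : V, v ≠ 0 ∧ W i = Submodule.span ℂ {v} := by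
    intro i
    obtain ⟨v, hv, hspan⟩ := finrank_eq_one_iff'.1 (hline i)
    refine ⟨v, by simpa using hv, le_antisymm (fun w hw => ?_) ?_⟩
    · obtain ⟨c, hc⟩ := hspan ⟨w, hw⟩
      rw [Submodule.mem_span_singleton]
      exact ⟨c, by simpa using congrArg Subtype.val hc⟩
    · simp
  choose v hv0 hspan using hv
  let f := Fintype.linearCombination ℂ v
  have hf : ∀ x, f x = ∑ i, x i • v i := fun x => Fintype.linearCombination_apply ℂ v x
  have hfsurj : LinearMap.range f = ⊤ := by
    rw [Fintype.range_linearCombination, Submodule.span_range_eq_iSup, ← htop]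
    simp_rw [hspan]
  have hker : finrank ℂ (LinearMap.ker f) = 1 := by
    have := LinearMap.finrank_range_add_finrank_ker f
    rw [hfsurj, finrank_top, hn, Module.finrank_fin_fun] at this
    omega
  obtain ⟨⟨c, hc⟩, hc0, hcspan⟩ := finrank_eq_one_iff'.1 hker
  have hrel : ∀ x, f x = 0 → ∃ t : ℂ, x = t • c := by
    intro x hx
    obtain ⟨t, ht⟩ := hcspan ⟨x, hx⟩
    exact ⟨t, by simpa using (congrArg Subtype.val ht).symm⟩
  rw [LinearMap.mem_ker, hf] at hc
  obtain ⟨j, hj⟩ : ∃ j, c j ≠ 0 := by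
    by_contra! h
    exact hc0 (Subtype.ext (funext h))
  -- a symmetry exchanging `i` and `j` carries the relation to a multiple of itself
  have hci : ∀ i, c i ≠ 0 := by
    intro i
    obtain ⟨P, hP⟩ := hW.2 (Equiv.swap i j)
    have ha : ∀ m, ∃ a : ℂ, P (v m) = a • v (Equiv.swap i j m) := by
      intro m
      have : P (v m) ∈ W (Equiv.swap i j m) := by
        rw [← hP m]
        exact Submodule.mem_map_of_mem (by rw [hspan]; exact Submodule.mem_span_singleton_self _)
      rw [hspan, Submodule.mem_span_singleton] at this
      exact this.imp fun a h => h.symm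
    choose a ha using ha
    have ha0 : ∀ m, a m ≠ 0 := by
      intro m h
      have := ha m
      rw [h, zero_smul, LinearEquiv.map_eq_zero_iff] at this
      exact hv0 m this
    have h0 : f (fun m => c (Equiv.swap i j m) * a (Equiv.swap i j m)) = 0 := by
      have := congrArg P hc
      rw [map_sum, map_zero] at this
      rw [hf, ← this, ← Equiv.sum_comp (Equiv.swap i j)]
      refine Finset.sum_congr rfl fun m _ => ?_
      rw [map_smul, ha, smul_smul, Equiv.swap_apply_self]
    obtain ⟨t, ht⟩ := hrel _ h0
    have hti := congrFun ht i
    simp only [Equiv.swap_apply_left, Pi.smul_apply, smul_eq_mul] at hti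
    intro h
    rw [h, mul_zero] at hti
    exact mul_ne_zero hj (ha0 j) hti
  -- rescaling the `v i` by the coefficients of the relation makes them sum to zero
  let g := Fintype.linearCombination ℂ fun i => c i • v i
  have hg : ∀ x, g x = ∑ i, x i • c i • v i := fun x => Fintype.linearCombination_apply ℂ _ x
  have hgf : ∀ x, g x = f (fun i => x i * c i) := fun x => by simp only [hg, hf, smul_smul]
  have hgsurj : Function.Surjective g := by
    intro w
    obtain ⟨x, hx⟩ := LinearMap.range_eq_top.1 hfsurj w
    refine ⟨fun i => x i * (c i)⁻¹, ?_⟩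
    rw [hgf, ← hx]
    congr 1
    funext i
    rw [mul_assoc, inv_mul_cancel₀ (hci i), mul_one]
  have hgker : gammaLine n = LinearMap.ker g := by
    ext x
    rw [gammaLine, Submodule.mem_span_singleton, LinearMap.mem_ker, hgf]
    constructor
    · rintro ⟨t, rfl⟩
      have : (fun i => (t • fun _ : Fin (n + 1) => (1 : ℂ)) i * c i) = t • c := by
        ext i
        simp
      rw [this, map_smul, hf, hc, smul_zero]
    · intro h
      obtain ⟨t, ht⟩ := hrel _ h
      refine ⟨t, funext fun i => ?_⟩
      have := congrFun ht i
      simp only [Pi.smul_apply, smul_eq_mul] at this ⊢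
      rw [mul_one]
      exact (mul_right_cancel₀ (hci i) this).symm
  let e : StdRep n ≃ₗ[ℂ] V :=
    (Submodule.quotEquivOfEq _ _ hgker).trans (g.quotKerEquivOfSurjective hgsurj)
  have he : ∀ i, e ((gammaLine n).mkQ (Pi.single i 1)) = c i • v i := by
    intro i
    have : e ((gammaLine n).mkQ (Pi.single i 1)) = g (Pi.single i 1) := rfl
    rw [this, Fintype.linearCombination_apply_single, one_smul]
  refine ⟨e.symm, fun i => ?_⟩
  have hWi : W i = Submodule.span ℂ {c i • v i} := by
    rw [hspan]
    exact (Submodule.span_singleton_smul_eq (IsUnit.mk0 _ (hci i)) (v i)).symm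
  rw [hWi, Submodule.map_span, Set.image_singleton, ← he i]
  simp [simplexArrangement]

/-- A symmetric arrangement is determined by its dual. -/
theorem ArrangementIso.of_dual {ι V V' : Type*} [AddCommGroup V] [Module ℂ V]
    [FiniteDimensional ℂ V] [AddCommGroup V'] [Module ℂ V'] {W : ι → Submodule ℂ V}
    {W' : ι → Submodule ℂ V'} (h : ArrangementIso (dualArrangement W) W') :
    ArrangementIso W (dualArrangement W') := by
  obtain ⟨T, hT⟩ := h
  refine ⟨(evalEquiv ℂ V).trans T.symm.dualMap, fun i => ?_⟩
  rw [dualArrangement, ← map_dualMap_symm_dualAnnihilator T (hT i), LinearEquiv.coe_trans,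
    Submodule.map_comp]
  congr 1
  rw [Submodule.map_linearEquiv_eq_iff]
  intro x
  rw [Submodule.mem_dualAnnihilator, ← Subspace.forall_mem_dualAnnihilator_apply_eq_zero_iff]
  rfl

/-! ### Pairwise complementary subspaces as graphs of matrices -/

/-- Coordinates `e : ℂᵈ × ℂᵈ ≃ V` in which `W a` is `ℂᵈ × 0` and every other `W i` is the graph
`{(A i y, y)}` of the matrix `A i`. The matrix `A a` plays no role. -/
structure IsGraphChart {ι V : Type} [AddCommGroup V] [Module ℂ V] {d : ℕ}
    (W : ι → Submodule ℂ V) (a : ι) (e : ((Fin d → ℂ) × (Fin d → ℂ)) ≃ₗ[ℂ] V)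
    (A : ι → Matrix (Fin d) (Fin d) ℂ) : Prop where
  mem_base : ∀ x y, e (x, y) ∈ W a ↔ y = 0
  mem_graph : ∀ i, i ≠ a → ∀ x y, e (x, y) ∈ W i ↔ x = A i *ᵥ y

/-- Two further members of the arrangement can be placed on the graphs of `0` and `1`. -/
theorem exists_isGraphChart {ι V : Type} [AddCommGroup V] [Module ℂ V] [FiniteDimensional ℂ V]
    {d : ℕ} {W : ι → Submodule ℂ V} (hc : ∀ i j, i ≠ j → IsCompl (W i) (W j))
    (hd : ∀ i, finrank ℂ (W i) = d) {a b c : ι} (hab : b ≠ a) (hac : c ≠ a) (hbc : b ≠ c) :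
    ∃ (e : ((Fin d → ℂ) × (Fin d → ℂ)) ≃ₗ[ℂ] V) (A : ι → Matrix (Fin d) (Fin d) ℂ),
      IsGraphChart W a e A ∧ A b = 0 ∧ A c = 1 := by
  have hdim : finrank ℂ V = d + d := by
    rw [← Submodule.finrank_add_eq_of_isCompl (hc b a hab), hd, hd]
  obtain ⟨π, hπsurj, hπker⟩ : ∃ π : V →ₗ[ℂ] (Fin d → ℂ), Function.Surjective π ∧
      ∀ v, π v = 0 ↔ v ∈ W a := by
    have hq : finrank ℂ (V ⧸ W a) = finrank ℂ (Fin d → ℂ) := by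
      have := Submodule.finrank_quotient_add_finrank (W a)
      rw [hd] at this
      rw [Module.finrank_fin_fun]
      omega
    refine ⟨(LinearEquiv.ofFinrankEq _ _ hq : _ →ₗ[ℂ] _) ∘ₗ (W a).mkQ, ?_, fun v => ?_⟩
    · exact (LinearEquiv.surjective _).comp (Submodule.mkQ_surjective _)
    · simp
  -- each member other than `W a` is the image of a section of the projection along `W a`
  have hs : ∀ i, ∃ s : (Fin d → ℂ) →ₗ[ℂ] V, i ≠ a → (∀ u, s u ∈ W i) ∧ ∀ u, π (s u) = u := by
    intro i
    by_cases hi : i = a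
    · exact ⟨0, fun h => absurd hi h⟩
    · have hsurj : LinearMap.range (π ∘ₗ (W i).subtype) = ⊤ := by
        rw [LinearMap.range_eq_top]
        intro u
        obtain ⟨v, rfl⟩ := hπsurj u
        have hv : v ∈ W a ⊔ W i := by
          rw [(hc a i (Ne.symm hi)).sup_eq_top]
          exact Submodule.mem_top
        obtain ⟨y, hy, z, hz, rfl⟩ := Submodule.mem_sup.1 hv
        exact ⟨⟨z, hz⟩, by simp [(hπker y).2 hy]⟩
      obtain ⟨g, hg⟩ := LinearMap.exists_rightInverse_of_surjective _ hsurj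
      exact ⟨(W i).subtype ∘ₗ g, fun _ => ⟨fun u => (g u).2, fun u => LinearMap.congr_fun hg u⟩⟩
  choose s hs using hs
  have hsmem : ∀ i, i ≠ a → ∀ v, v ∈ W i ↔ s i (π v) = v := by
    intro i hi v
    refine ⟨fun hv => ?_, fun h => h ▸ (hs i hi).1 _⟩
    have h1 : s i (π v) - v ∈ W i := sub_mem ((hs i hi).1 _) hv
    have h2 : s i (π v) - v ∈ W a := by
      rw [← hπker, map_sub, (hs i hi).2, sub_self]
    exact sub_eq_zero.1 ((Submodule.disjoint_def.1 (hc i a hi).disjoint) _ h1 h2)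
  have hdiff : ∀ i, i ≠ a → ∀ u, s i u - s b u ∈ W a := by
    intro i hi u
    rw [← hπker, map_sub, (hs i hi).2, (hs b hab).2, sub_self]
  -- differences of sections take values in `W a`; that of `s c` and `s b` identifies it with `ℂᵈ`
  let j := s c - s b
  have hjinj : LinearMap.ker j = ⊥ := by
    rw [LinearMap.ker_eq_bot']
    intro u hu
    have h1 : s c u = s b u := sub_eq_zero.1 hu
    have h0 := Submodule.disjoint_def.1 (hc b c hbc).disjoint _ ((hs b hab).1 u)
      (h1 ▸ (hs c hac).1 u)
    rw [← (hs b hab).2 u, h0, map_zero]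
  have hjrange : LinearMap.range j = W a := by
    apply Submodule.eq_of_le_of_finrank_eq
    · rintro _ ⟨u, rfl⟩
      exact hdiff c hac u
    · rw [hd, LinearMap.finrank_range_of_inj (LinearMap.ker_eq_bot.1 hjinj),
        Module.finrank_fin_fun]
  obtain ⟨g, hg⟩ := LinearMap.exists_leftInverse_of_injective j hjinj
  have hgj : ∀ u, g (j u) = u := fun u => LinearMap.congr_fun hg u
  have hjg : ∀ v ∈ W a, j (g v) = v := by
    intro v hv
    rw [← hjrange] at hv
    obtain ⟨u, rfl⟩ := hv
    rw [hgj]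
  have hπj : ∀ x, π (j x) = 0 := fun x => (hπker _).2 (hdiff c hac x)
  have hbij : Function.Bijective (j.coprod (s b)) := by
    constructor
    · rw [← LinearMap.ker_eq_bot, LinearMap.ker_eq_bot']
      rintro ⟨x, y⟩ h
      rw [LinearMap.coprod_apply] at h
      have hy : y = 0 := by
        have := congrArg π h
        simpa [hπj, (hs b hab).2] using this
      subst hy
      rw [map_zero, add_zero] at h
      rw [← hgj x, h, map_zero]
      rfl
    · intro v
      refine ⟨(g (v - s b (π v)), π v), ?_⟩
      rw [LinearMap.coprod_apply, hjg, sub_add_cancel]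
      rw [← hπker, map_sub, (hs b hab).2, sub_self]
  have he : ∀ x y, LinearEquiv.ofBijective _ hbij (x, y) = j x + s b y := fun x y => by
    rw [LinearEquiv.ofBijective_apply, LinearMap.coprod_apply]
  have hπe : ∀ x y, π (j x + s b y) = y := fun x y => by
    rw [map_add, hπj, (hs b hab).2, zero_add]
  refine ⟨LinearEquiv.ofBijective _ hbij, fun i => LinearMap.toMatrix' (g ∘ₗ (s i - s b)), ⟨?_, ?_⟩,
    ?_, ?_⟩
  · intro x y
    rw [← hπker, he, hπe]
  · intro i hi x y
    rw [hsmem i hi, he, hπe, LinearMap.toMatrix'_mulVec]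
    change s i y = j x + s b y ↔ x = g (s i y - s b y)
    rw [← sub_eq_iff_eq_add]
    constructor
    · intro h
      rw [h, hgj]
    · intro h
      rw [h, hjg _ (hdiff i hi y)]
  · simp
  · change LinearMap.toMatrix' (g ∘ₗ j) = 1
    rw [hg, LinearMap.toMatrix'_id]

namespace IsGraphChart

variable {ι V : Type} [AddCommGroup V] [Module ℂ V] {d : ℕ} {W : ι → Submodule ℂ V} {a : ι}
  {e : ((Fin d → ℂ) × (Fin d → ℂ)) ≃ₗ[ℂ] V} {A : ι → Matrix (Fin d) (Fin d) ℂ}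

theorem isUnit_sub (h : IsGraphChart W a e A) (hc : ∀ i j, i ≠ j → IsCompl (W i) (W j)) {i j : ι}
    (hi : i ≠ a) (hj : j ≠ a) (hij : i ≠ j) : IsUnit (A i - A j) := by
  rw [← Matrix.mulVec_injective_iff_isUnit, ← Matrix.coe_mulVecLin, ← LinearMap.ker_eq_bot,
    LinearMap.ker_eq_bot']
  intro u hu
  rw [Matrix.mulVecLin_apply, Matrix.sub_mulVec, sub_eq_zero] at hu
  have h0 := Submodule.disjoint_def.1 (hc i j hij).disjoint (e (A i *ᵥ u, u))
    ((h.mem_graph i hi _ _).2 rfl) ((h.mem_graph j hj _ _).2 hu)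
  rw [LinearEquiv.map_eq_zero_iff, Prod.mk_eq_zero] at h0
  exact h0.2

/-- A symmetry fixing `W a` is block upper triangular in a graph chart. -/
theorem exists_affine (h : IsGraphChart W a e A) (hW : IsTotallySymmetricArrangement W)
    (σ : Equiv.Perm {i // i ≠ a}) :
    ∃ p q r : Matrix (Fin d) (Fin d) ℂ, IsUnit p ∧ IsUnit q ∧
      ∀ i : {i // i ≠ a}, p * A i + r = A (σ i) * q := by
  obtain ⟨P, hPa, hP⟩ := hW.exists_fixing a σ
  rw [Submodule.map_linearEquiv_eq_iff] at hPa
  simp_rw [Submodule.map_linearEquiv_eq_iff] at hP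
  let Q := (e.trans P).trans e.symm
  have hQ : ∀ z, P (e z) = e ((Q z).1, (Q z).2) := by
    intro z
    simp [Q]
  have hQa : ∀ x y, (Q (x, y)).2 = 0 ↔ y = 0 := by
    intro x y
    rw [← h.mem_base x y, ← hPa, hQ, h.mem_base]
  have hQi : ∀ (i : {i // i ≠ a}) (y), (Q (A i *ᵥ y, y)).1 = A (σ i) *ᵥ (Q (A i *ᵥ y, y)).2 := by
    intro i y
    have h1 := (hP i _).2 ((h.mem_graph i i.2 _ y).2 rfl)
    rw [hQ, h.mem_graph _ (σ i).2] at h1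
    exact h1
  have hsplit : ∀ x y, Q (x, y) = Q (x, 0) + Q (0, y) := by
    intro x y
    rw [← map_add]
    simp
  let q := LinearMap.snd ℂ _ _ ∘ₗ Q.toLinearMap ∘ₗ LinearMap.inr ℂ (Fin d → ℂ) (Fin d → ℂ)
  let r := LinearMap.fst ℂ _ _ ∘ₗ Q.toLinearMap ∘ₗ LinearMap.inr ℂ (Fin d → ℂ) (Fin d → ℂ)
  let p := LinearMap.fst ℂ _ _ ∘ₗ Q.toLinearMap ∘ₗ LinearMap.inl ℂ (Fin d → ℂ) (Fin d → ℂ)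
  have hq : ∀ x y, (Q (x, y)).2 = q y := by
    intro x y
    rw [hsplit, Prod.snd_add, (hQa x 0).2 rfl, zero_add]
    rfl
  have hunit : ∀ f : (Fin d → ℂ) →ₗ[ℂ] (Fin d → ℂ), (∀ y, f y = 0 → y = 0) →
      IsUnit (LinearMap.toMatrix' f) := by
    intro f hf
    rw [← Matrix.mulVec_injective_iff_isUnit, ← Matrix.coe_mulVecLin, ← LinearMap.ker_eq_bot,
      LinearMap.ker_eq_bot']
    intro y hy
    rw [Matrix.mulVecLin_apply, LinearMap.toMatrix'_mulVec] at hy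
    exact hf y hy
  refine ⟨LinearMap.toMatrix' p, LinearMap.toMatrix' q, LinearMap.toMatrix' r, hunit p ?_,
    hunit q fun y hy => ?_, fun i => ?_⟩
  · intro x hx
    have : Q (x, 0) = 0 := Prod.ext hx ((hQa x 0).2 rfl)
    rw [LinearEquiv.map_eq_zero_iff, Prod.mk_eq_zero] at this
    exact this.1
  · rw [← hQa 0, hq, hy]
  · refine Matrix.toLin'.injective (LinearMap.ext fun y => ?_)
    simp only [map_add, Matrix.toLin'_mul, Matrix.toLin'_toMatrix', LinearMap.add_apply,
      LinearMap.comp_apply, Matrix.toLin'_apply]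
    have := hQi i y
    rw [hq, hsplit, Prod.fst_add] at this
    exact this

end IsGraphChart

/-! ### Families of matrices with affine symmetry -/

/-- A family of `d × d` matrices containing `0` and `1`, with invertible differences, all of whose
permutations are realized by affine substitutions `X ↦ (p X + r) q⁻¹`. -/
structure IsAffineFamily {κ : Type} {d : ℕ} (A : κ → Matrix (Fin d) (Fin d) ℂ) (b c : κ) :
    Prop where
  ne : b ≠ c
  zero : A b = 0
  one : A c = 1
  isUnit_sub : ∀ i j, i ≠ j → IsUnit (A i - A j)
  affine : ∀ σ : Equiv.Perm κ, ∃ p q r : Matrix (Fin d) (Fin d) ℂ, IsUnit p ∧ IsUnit q ∧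
    ∀ i, p * A i + r = A (σ i) * q

theorem trace_eq_of_conj {d : ℕ} {q X Y : Matrix (Fin d) (Fin d) ℂ} (hq : IsUnit q)
    (h : q * X = Y * q) : X.trace = Y.trace := by
  obtain ⟨u, rfl⟩ := hq
  rw [← Matrix.trace_units_conj u X, h, mul_assoc, Units.mul_inv, mul_one]

theorem det_eq_of_conj {d : ℕ} {q X Y : Matrix (Fin d) (Fin d) ℂ} (hq : IsUnit q)
    (h : q * X = Y * q) : X.det = Y.det := by
  obtain ⟨u, rfl⟩ := hq
  rw [← Matrix.det_units_conj u X, h, mul_assoc, Units.mul_inv, mul_one]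

/-- A `d × d` matrix with `d` distinct eigenvalues is diagonalizable. -/
theorem exists_mul_eq_mul_diagonal {d : ℕ} (A : Matrix (Fin d) (Fin d) ℂ) (μ : Fin d → ℂ)
    (hμ : Function.Injective μ) (h : ∀ k, (A - μ k • (1 : Matrix (Fin d) (Fin d) ℂ)).det = 0) :
    ∃ S : Matrix (Fin d) (Fin d) ℂ, IsUnit S ∧ A * S = S * diagonal μ := by
  have hv : ∀ k, ∃ v : Fin d → ℂ, v ≠ 0 ∧ A *ᵥ v = μ k • v := by
    intro k
    obtain ⟨v, hv, hv0⟩ := Matrix.exists_mulVec_eq_zero_iff.2 (h k)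
    refine ⟨v, hv, ?_⟩
    rwa [Matrix.sub_mulVec, Matrix.smul_mulVec, Matrix.one_mulVec, sub_eq_zero] at hv0
  choose v hv0 hv using hv
  refine ⟨(Matrix.of v)ᵀ, ?_, ?_⟩
  · rw [← Matrix.linearIndependent_cols_iff_isUnit]
    refine Module.End.eigenvectors_linearIndependent' (Matrix.toLin' A) μ hμ v fun k => ?_
    rw [Module.End.hasEigenvector_iff, Module.End.mem_eigenspace_iff]
    exact ⟨hv k, hv0 k⟩
  · ext i k
    rw [Matrix.mul_diagonal]
    have := congrFun (hv k) i
    rw [Pi.smul_apply, smul_eq_mul, mul_comm] at this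
    exact this

theorem eq_diagonal_of_commute {d : ℕ} {μ : Fin d → ℂ} (hμ : Function.Injective μ)
    {q : Matrix (Fin d) (Fin d) ℂ} (h : q * diagonal μ = diagonal μ * q) :
    q = diagonal q.diag := by
  ext i j
  rw [Matrix.diagonal_apply]
  split_ifs with hij
  · rw [hij]
    rfl
  · have := congrFun (congrFun h i) j
    rw [Matrix.mul_diagonal, Matrix.diagonal_mul, mul_comm] at this
    by_contra h0
    exact hij (hμ (mul_right_cancel₀ h0 this)).symm

namespace IsAffineFamily

variable {κ : Type} {d : ℕ} {A : κ → Matrix (Fin d) (Fin d) ℂ} {b c : κ}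

/-- Simultaneous conjugation preserves the affine symmetry. -/
theorem conj (h : IsAffineFamily A b c) (S : (Matrix (Fin d) (Fin d) ℂ)ˣ) :
    IsAffineFamily (fun i => (S⁻¹).val * A i * S.val) b c where
  ne := h.ne
  zero := by simp [h.zero]
  one := by simp [h.one]
  isUnit_sub i j hij := by
    rw [← sub_mul, ← mul_sub]
    exact ((S⁻¹).isUnit.mul (h.isUnit_sub i j hij)).mul S.isUnit
  affine σ := by
    obtain ⟨p, q, r, hp, hq, H⟩ := h.affine σ
    refine ⟨(S⁻¹).val * p * S.val, (S⁻¹).val * q * S.val, (S⁻¹).val * r * S.val,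
      ((S⁻¹).isUnit.mul hp).mul S.isUnit, ((S⁻¹).isUnit.mul hq).mul S.isUnit, fun i => ?_⟩
    calc (S⁻¹).val * p * S.val * ((S⁻¹).val * A i * S.val) + (S⁻¹).val * r * S.val
        = (S⁻¹).val * (p * A i + r) * S.val := by
          simp only [mul_assoc, Units.mul_inv_cancel_left, mul_add, add_mul]
      _ = (S⁻¹).val * (A (σ i) * q) * S.val := by rw [H]
      _ = (S⁻¹).val * A (σ i) * S.val * ((S⁻¹).val * q * S.val) := by
          simp only [mul_assoc, Units.mul_inv_cancel_left]

theorem exists_conj (h : IsAffineFamily A b c) {σ : Equiv.Perm κ} (hb : σ b = b) (hc : σ c = c) :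
    ∃ q, IsUnit q ∧ ∀ i, q * A i = A (σ i) * q := by
  obtain ⟨p, q, r, hp, hq, H⟩ := h.affine σ
  have hr : r = 0 := by simpa [hb, h.zero] using H b
  subst hr
  have hpq : p = q := by simpa [hc, h.one] using H c
  subst hpq
  exact ⟨p, hp, fun i => by simpa using H i⟩

/-- Exchanging `0` and `1` conjugates `A i` to `1 - A i`. -/
theorem exists_conj_one_sub (h : IsAffineFamily A b c) {i : κ} (hib : i ≠ b) (hic : i ≠ c) :
    ∃ q, IsUnit q ∧ q * (1 - A i) = A i * q := by
  classical
  obtain ⟨p, q, r, hp, hq, H⟩ := h.affine (Equiv.swap b c)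
  have hr : r = q := by simpa [h.zero, h.one] using H b
  have hpr : p + r = 0 := by simpa [h.zero, h.one] using H c
  have hi := H i
  rw [Equiv.swap_apply_of_ne_of_ne hib hic, eq_neg_of_add_eq_zero_left hpr, hr] at hi
  refine ⟨q, hq, ?_⟩
  rw [← hi]
  noncomm_ring

/-- Exchanging `1` and `A i` conjugates `A i` to its inverse and every other `A j` to
`(A i)⁻¹ * A j`. -/
theorem exists_conj_inv (h : IsAffineFamily A b c) {i : κ} (hib : i ≠ b) :
    ∃ q, IsUnit q ∧ A i * q * A i = q ∧ ∀ j, j ≠ c → j ≠ i → A i * q * A j = A j * q := by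
  classical
  obtain ⟨p, q, r, hp, hq, H⟩ := h.affine (Equiv.swap c i)
  have hr : r = 0 := by
    simpa [h.zero, Equiv.swap_apply_of_ne_of_ne h.ne hib.symm] using H b
  subst hr
  have hp' : p = A i * q := by simpa [h.one] using H c
  refine ⟨q, hq, ?_, fun j hjc hji => ?_⟩
  · rw [← hp']
    simpa [h.one] using H i
  · rw [← hp']
    simpa [Equiv.swap_apply_of_ne_of_ne hjc hji] using H j

theorem isUnit (h : IsAffineFamily A b c) {i : κ} (hib : i ≠ b) : IsUnit (A i) := by
  simpa [h.zero] using h.isUnit_sub i b hib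

/-! ### Eigenvalues -/

theorem det_sub_one_sub (h : IsAffineFamily A b c) {i : κ} (hib : i ≠ b) (hic : i ≠ c) {μ : ℂ}
    (hμ : (A i - μ • (1 : Matrix (Fin d) (Fin d) ℂ)).det = 0) :
    (A i - (1 - μ) • (1 : Matrix (Fin d) (Fin d) ℂ)).det = 0 := by
  obtain ⟨q, hq, H⟩ := h.exists_conj_one_sub hib hic
  have := det_eq_of_conj (X := -(A i - (1 - μ) • 1)) (Y := A i - μ • 1) hq (by
    rw [sub_mul, ← H, sub_smul, one_smul]
    simp only [mul_neg, mul_sub, mul_one, Algebra.mul_smul_comm, Algebra.smul_mul_assoc, one_mul]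
    abel)
  rw [hμ, Matrix.det_neg] at this
  simpa using this

theorem det_sub_inv (h : IsAffineFamily A b c) {i : κ} (hib : i ≠ b) {μ : ℂ}
    (h0 : μ ≠ 0) (hμ : (A i - μ • (1 : Matrix (Fin d) (Fin d) ℂ)).det = 0) :
    (A i - μ⁻¹ • (1 : Matrix (Fin d) (Fin d) ℂ)).det = 0 := by
  obtain ⟨q, hq, H, -⟩ := h.exists_conj_inv hib
  have key : (A i - μ⁻¹ • 1) * (q * A i) = (-μ⁻¹) • (q * (A i - μ • 1)) := by
    rw [sub_mul, ← mul_assoc, H, mul_sub, smul_sub]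
    simp only [Algebra.mul_smul_comm, Algebra.smul_mul_assoc, one_mul, mul_one, smul_smul]
    rw [neg_mul, inv_mul_cancel₀ h0, neg_smul, neg_smul, one_smul]
    abel
  have hdet := congrArg Matrix.det key
  rw [Matrix.det_mul, Matrix.det_smul, Matrix.det_mul q (A i - μ • 1), hμ, mul_zero,
    mul_zero] at hdet
  have hu := (Matrix.isUnit_iff_isUnit_det _).1 (hq.mul (h.isUnit hib))
  exact (mul_eq_zero.1 hdet).resolve_right hu.ne_zero

/-- In odd dimension `1/2` is an eigenvalue, since `A i - 1/2` is conjugate to its negative. -/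
theorem det_sub_half (h : IsAffineFamily A b c) (hd : Odd d) {i : κ} (hib : i ≠ b) (hic : i ≠ c) :
    (A i - (1 / 2 : ℂ) • (1 : Matrix (Fin d) (Fin d) ℂ)).det = 0 := by
  obtain ⟨q, hq, H⟩ := h.exists_conj_one_sub hib hic
  have := det_eq_of_conj (X := -(A i - (1 / 2 : ℂ) • 1)) (Y := A i - (1 / 2 : ℂ) • 1) hq (by
    have h2 : (1 : Matrix (Fin d) (Fin d) ℂ) = (1 / 2 : ℂ) • 1 + (1 / 2 : ℂ) • 1 := by
      rw [← add_smul]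
      norm_num
    rw [sub_mul, ← H]
    nth_rw 2 [h2]
    simp only [mul_neg, mul_sub, mul_add, mul_one, Algebra.mul_smul_comm, Algebra.smul_mul_assoc,
      one_mul]
    abel)
  rw [Matrix.det_neg, Fintype.card_fin, hd.neg_one_pow] at this
  linear_combination (-1 / 2) * this

theorem det_sub_two (h : IsAffineFamily A b c) (hd : Odd d) {i : κ} (hib : i ≠ b) (hic : i ≠ c) :
    (A i - (2 : ℂ) • (1 : Matrix (Fin d) (Fin d) ℂ)).det = 0 := by
  have := h.det_sub_inv hib (by norm_num) (h.det_sub_half hd hib hic)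
  norm_num at this
  exact this

theorem det_sub_neg_one (h : IsAffineFamily A b c) (hd : Odd d) {i : κ} (hib : i ≠ b)
    (hic : i ≠ c) : (A i - (-1 : ℂ) • (1 : Matrix (Fin d) (Fin d) ℂ)).det = 0 := by
  have := h.det_sub_one_sub hib hic (h.det_sub_two hd hib hic)
  norm_num at this ⊢
  exact this

/-! ### Excluding odd and large dimensions -/

theorem dim_ne_one (h : IsAffineFamily A b c) {i : κ} (hib : i ≠ b) (hic : i ≠ c) : d ≠ 1 := by
  rintro rfl
  have h1 := h.det_sub_half odd_one hib hic
  have h2 := h.det_sub_two odd_one hib hic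
  simp only [Matrix.det_unique, Matrix.sub_apply, Matrix.smul_apply, Matrix.one_apply_eq,
    smul_eq_mul] at h1 h2
  have : (3 / 2 : ℂ) = 0 := by linear_combination h1 - h2
  norm_num at this

/-- In dimension three `A i` has three distinct eigenvalues, so the matrices realizing the
permutations of three further indices commute, although these permutations do not. -/
theorem dim_ne_three (h : IsAffineFamily A b c) {i j k l : κ} (hib : i ≠ b) (hic : i ≠ c)
    (hj : j ≠ b ∧ j ≠ c ∧ j ≠ i) (hk : k ≠ b ∧ k ≠ c ∧ k ≠ i) (hl : l ≠ b ∧ l ≠ c ∧ l ≠ i)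
    (hjk : j ≠ k) (hjl : j ≠ l) (hkl : k ≠ l) : d ≠ 3 := by
  classical
  rintro rfl
  let μ : Fin 3 → ℂ := ![1 / 2, 2, -1]
  have hμ : Function.Injective μ := by
    intro x y hxy
    fin_cases x <;> fin_cases y <;> first | rfl | (norm_num [μ] at hxy)
  have hodd : Odd 3 := by decide
  obtain ⟨_, ⟨S, rfl⟩, hS⟩ := exists_mul_eq_mul_diagonal (A i) μ hμ (by
    intro x
    fin_cases x
    · exact h.det_sub_half hodd hib hic
    · exact h.det_sub_two hodd hib hic
    · exact h.det_sub_neg_one hodd hib hic)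
  have h' := h.conj S
  have hdiag : (S⁻¹).val * A i * S.val = diagonal μ := by
    rw [mul_assoc, hS, Units.inv_mul_cancel_left]
  obtain ⟨q₁, hq₁, H₁⟩ := h'.exists_conj (σ := Equiv.swap j k)
    (Equiv.swap_apply_of_ne_of_ne hj.1.symm hk.1.symm)
    (Equiv.swap_apply_of_ne_of_ne hj.2.1.symm hk.2.1.symm)
  obtain ⟨q₂, hq₂, H₂⟩ := h'.exists_conj (σ := Equiv.swap k l)
    (Equiv.swap_apply_of_ne_of_ne hk.1.symm hl.1.symm)
    (Equiv.swap_apply_of_ne_of_ne hk.2.1.symm hl.2.1.symm)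
  have e₁ := H₁ i
  have e₂ := H₂ i
  rw [Equiv.swap_apply_of_ne_of_ne hj.2.2.symm hk.2.2.symm, hdiag] at e₁
  rw [Equiv.swap_apply_of_ne_of_ne hk.2.2.symm hl.2.2.symm, hdiag] at e₂
  have hcomm : q₁ * q₂ = q₂ * q₁ := by
    rw [eq_diagonal_of_commute hμ e₁, eq_diagonal_of_commute hμ e₂, Matrix.diagonal_mul_diagonal,
      Matrix.diagonal_mul_diagonal]
    simp_rw [mul_comm]
  have f₁ := H₁ j
  have f₂ := H₂ j
  have f₃ := H₂ k
  rw [Equiv.swap_apply_left] at f₁ f₃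
  rw [Equiv.swap_apply_of_ne_of_ne hjk hjl] at f₂
  have f₄ := H₁ k
  -- the two orders of composition carry the matrix of index `j` to those of indices `k` and `l`
  have hX : ((S⁻¹).val * A k * S.val - (S⁻¹).val * A l * S.val) * (q₁ * q₂) = 0 := by
    rw [sub_mul, sub_eq_zero]
    calc (S⁻¹).val * A k * S.val * (q₁ * q₂) = q₁ * q₂ * ((S⁻¹).val * A j * S.val) := by
          rw [← mul_assoc, ← f₁, mul_assoc q₁, ← f₂, mul_assoc q₁]
      _ = (S⁻¹).val * A l * S.val * (q₁ * q₂) := by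
          rw [hcomm, mul_assoc q₂, f₁, ← mul_assoc q₂, f₃, mul_assoc _ q₂]
  have := (h'.isUnit_sub k l hkl).mul (hq₁.mul hq₂)
  rw [hX] at this
  exact not_isUnit_zero this

theorem card_others [Fintype κ] [DecidableEq κ] (h : IsAffineFamily A b c) :
    Fintype.card {i // i ≠ b ∧ i ≠ c} + 2 = Fintype.card κ := by
  have hpos : 1 < Fintype.card κ := Fintype.one_lt_card_iff.2 ⟨b, c, h.ne⟩
  rw [Fintype.card_of_subtype ((Finset.univ.erase b).erase c) (by simp [and_comm]),
    Finset.card_erase_of_mem (by simp [h.ne.symm]), Finset.card_erase_of_mem (Finset.mem_univ _),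
    Finset.card_univ]
  omega

/-- The eigenspaces of the `A i` with `i ≠ b, c` for a common eigenvalue form a nondegenerate
symmetric arrangement, two subspaces smaller than the family. -/
theorem card_le [Fintype κ] {n : ℕ} (ih : CardBoundBelow n) (h : IsAffineFamily A b c)
    (hdn : d < n) (hd : 0 < d) (hcard : 4 ≤ Fintype.card κ) : Fintype.card κ ≤ d + 3 := by
  classical
  have hc := h.card_others
  obtain ⟨i₀, i₁, hne⟩ := Fintype.one_lt_card_iff.1
    (show 1 < Fintype.card {i // i ≠ b ∧ i ≠ c} by omega)
  have : NeZero d := ⟨hd.ne'⟩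
  obtain ⟨μ, hμ⟩ := Module.End.exists_eigenvalue (Matrix.toLin' (A i₀))
  obtain ⟨v, hv⟩ := hμ.exists_hasEigenvector
  have hmem : ∀ i w, w ∈ Module.End.eigenspace (Matrix.toLin' (A i)) μ ↔ A i *ᵥ w = μ • w := by
    intro i w
    rw [Module.End.mem_eigenspace_iff, Matrix.toLin'_apply]
  have := ih {i // i ≠ b ∧ i ≠ c} (Fin d → ℂ)
    (fun i => Module.End.eigenspace (Matrix.toLin' (A i)) μ) (by rwa [Module.finrank_fin_fun])
    (.of_forall_perm fun σ => by
      obtain ⟨q, hq, H⟩ := h.exists_conj (σ := Equiv.Perm.ofSubtype σ)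
        (Equiv.Perm.ofSubtype_apply_of_not_mem σ (by simp))
        (Equiv.Perm.ofSubtype_apply_of_not_mem σ (by simp))
      have hinj := Matrix.mulVec_injective_iff_isUnit.2 hq
      refine ⟨LinearEquiv.ofInjectiveEndo q.mulVecLin 
        (by rwa [Matrix.coe_mulVecLin]), fun i => ?_⟩
      rw [Submodule.map_linearEquiv_eq_iff]
      intro x
      have e := H i
      rw [Equiv.Perm.ofSubtype_apply_coe] at e
      rw [hmem, hmem, LinearEquiv.coe_ofInjectiveEndo, Matrix.mulVecLin_apply, Matrix.mulVec_mulVec,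
        ← e, ← Matrix.mulVec_mulVec, ← Matrix.mulVec_smul]
      exact hinj.eq_iff) (by
      rw [isDegenerateArrangement_iff]
      intro hdeg
      have h1 : v ∈ Module.End.eigenspace (Matrix.toLin' (A i₀)) μ := hv.1
      have h2 := h1
      rw [hdeg i₀ i₁, hmem] at h2
      rw [hmem] at h1
      have hu := Matrix.mulVec_injective_iff_isUnit.2
        (h.isUnit_sub i₀ i₁ (Subtype.coe_injective.ne hne))
      refine hv.2 (hu ?_)
      rw [Matrix.sub_mulVec, h1, h2, sub_self, Matrix.mulVec_zero])
  rw [Module.finrank_fin_fun] at this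
  omega

end IsAffineFamily

/-! ### Dimension two: the `Σ̃₅` arrangement -/

theorem zeta6_sq : zeta6 ^ 2 = zeta6 - 1 := by
  have h3 : (Real.sqrt 3 : ℂ) ^ 2 = 3 := by
    rw [← Complex.ofReal_pow, Real.sq_sqrt (by norm_num)]
    norm_num
  unfold zeta6
  linear_combination ((Real.sqrt 3 : ℂ) ^ 2 / 4) * Complex.I_sq - (1 / 4) * h3

theorem zeta6_inv : zeta6⁻¹ = 1 - zeta6 := by
  rw [inv_eq_iff_eq_inv, eq_comm, inv_eq_of_mul_eq_one_right]
  linear_combination -zeta6_sq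

theorem one_sub_two_mul_zeta6_ne_zero : 1 - 2 * zeta6 ≠ 0 := by
  intro h
  have h2 : (1 - 2 * zeta6) ^ 2 = -3 := by linear_combination 4 * zeta6_sq
  rw [h] at h2
  norm_num at h2

theorem injective_zeta6 : Function.Injective ![zeta6, zeta6⁻¹] := by
  rw [zeta6_inv]
  intro x y hxy
  have := one_sub_two_mul_zeta6_ne_zero
  fin_cases x <;> fin_cases y
  · rfl
  · have h : zeta6 = 1 - zeta6 := hxy
    exact absurd (by linear_combination -h) this
  · have h : 1 - zeta6 = zeta6 := hxy
    exact absurd (by linear_combination h) this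
  · rfl

/-- The diagonal block `A₄` of the `Σ̃₅` arrangement. -/
def tildeSigma5BlockFour : Matrix (Fin 2) (Fin 2) ℂ := !![zeta6, 0; 0, zeta6⁻¹]

/-- The block `A₅` of the `Σ̃₅` arrangement. -/
def tildeSigma5BlockFive : Matrix (Fin 2) (Fin 2) ℂ :=
  !![(3 + Complex.I * (Real.sqrt 3 : ℂ)) / 6, (Real.sqrt 2 : ℂ) * Complex.I / (Real.sqrt 3 : ℂ);
     (Real.sqrt 2 : ℂ) * Complex.I / (Real.sqrt 3 : ℂ), (3 - Complex.I * (Real.sqrt 3 : ℂ)) / 6]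

namespace IsAffineFamily

variable {κ : Type} {A : κ → Matrix (Fin 2) (Fin 2) ℂ} {b c : κ}

theorem trace_eq_one (h : IsAffineFamily A b c) {i : κ} (hib : i ≠ b) (hic : i ≠ c) :
    (A i).trace = 1 := by
  obtain ⟨q, hq, H⟩ := h.exists_conj_one_sub hib hic
  have := trace_eq_of_conj hq H
  rw [Matrix.trace_sub, Matrix.trace_one, Fintype.card_fin] at this
  push_cast at this
  linear_combination -(1 / 2) * this

/-- `A i` and its inverse are conjugate, and the trace of the inverse of a `2 × 2` matrix is the
trace divided by the determinant. -/
theorem det_eq_one (h : IsAffineFamily A b c) {i : κ} (hib : i ≠ b) (hic : i ≠ c) :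
    (A i).det = 1 := by
  obtain ⟨q, hq, H, -⟩ := h.exists_conj_inv hib
  have key : q * ((A i).det • A i) = (A i).adjugate * q := by
    conv_rhs => rw [← H]
    rw [← mul_assoc, ← mul_assoc, Matrix.adjugate_mul]
    simp
  have := trace_eq_of_conj hq key
  have hadj : (A i).adjugate.trace = (A i).trace := by
    rw [Matrix.adjugate_fin_two, Matrix.trace_fin_two, Matrix.trace_fin_two]
    exact add_comm _ _
  rw [Matrix.trace_smul, hadj, h.trace_eq_one hib hic] at this
  simpa using this

theorem trace_adjugate_mul (h : IsAffineFamily A b c) {i j : κ} (hib : i ≠ b) (hic : i ≠ c)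
    (hjb : j ≠ b) (hjc : j ≠ c) (hji : j ≠ i) : ((A i).adjugate * A j).trace = 1 := by
  obtain ⟨q, hq, -, H⟩ := h.exists_conj_inv hib
  rw [← h.trace_eq_one hjb hjc]
  refine (trace_eq_of_conj hq ?_).symm
  rw [mul_assoc, ← H j hjc hji, ← mul_assoc, ← mul_assoc, Matrix.adjugate_mul,
    h.det_eq_one hib hic]
  simp

/-- After a simultaneous conjugation, `A i` is diagonal with eigenvalues `ζ` and `ζ⁻¹`. -/
theorem exists_diagonal (h : IsAffineFamily A b c) {i : κ} (hib : i ≠ b) (hic : i ≠ c) :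
    ∃ S : (Matrix (Fin 2) (Fin 2) ℂ)ˣ, (S⁻¹).val * A i * S.val = tildeSigma5BlockFour := by
  have htr := h.trace_eq_one hib hic
  have hdet := h.det_eq_one hib hic
  rw [Matrix.trace_fin_two] at htr
  rw [Matrix.det_fin_two] at hdet
  have hchar : ∀ μ : ℂ, μ ^ 2 = μ - 1 →
      (A i - μ • (1 : Matrix (Fin 2) (Fin 2) ℂ)).det = 0 := by
    intro μ hμ
    simp [Matrix.det_fin_two]
    linear_combination hdet - μ * htr + hμ
  obtain ⟨_, ⟨S, rfl⟩, hS⟩ := exists_mul_eq_mul_diagonal (A i) ![zeta6, zeta6⁻¹] injective_zeta6 (by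
    intro k
    fin_cases k
    · exact hchar _ zeta6_sq
    · refine hchar _ ?_
      change (zeta6⁻¹) ^ 2 = zeta6⁻¹ - 1
      rw [zeta6_inv]
      linear_combination zeta6_sq)
  refine ⟨S, ?_⟩
  rw [mul_assoc, hS, Units.inv_mul_cancel_left, tildeSigma5BlockFour]
  ext x y
  fin_cases x <;> fin_cases y <;> simp

/-- If `A i` is in diagonal form, the entries of `A j` are determined up to conjugation by a
diagonal matrix. -/
theorem entries (h : IsAffineFamily A b c) {i j : κ} (hib : i ≠ b) (hic : i ≠ c)
    (hjb : j ≠ b) (hjc : j ≠ c) (hji : j ≠ i) (hi : A i = tildeSigma5BlockFour) :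
    A j 0 0 = (3 + Complex.I * (Real.sqrt 3 : ℂ)) / 6 ∧
    A j 1 1 = (3 - Complex.I * (Real.sqrt 3 : ℂ)) / 6 ∧ A j 0 1 * A j 1 0 = -2 / 3 := by
  have h3 : (Real.sqrt 3 : ℂ) ^ 2 = 3 := by
    rw [← Complex.ofReal_pow, Real.sq_sqrt (by norm_num)]
    norm_num
  have hI := Complex.I_sq
  have htr := h.trace_eq_one hjb hjc
  have hdet := h.det_eq_one hjb hjc
  have hadj := h.trace_adjugate_mul hib hic hjb hjc hji
  rw [hi, tildeSigma5BlockFour, Matrix.adjugate_fin_two, Matrix.trace_fin_two] at hadj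
  simp [Matrix.mul_apply, Fin.sum_univ_two] at hadj
  rw [Matrix.trace_fin_two] at htr
  rw [Matrix.det_fin_two] at hdet
  rw [zeta6_inv] at hadj
  have h00 : A j 0 0 = (3 + Complex.I * (Real.sqrt 3 : ℂ)) / 6 := by
    apply mul_left_cancel₀ one_sub_two_mul_zeta6_ne_zero
    unfold zeta6 at hadj ⊢
    linear_combination hadj - (1 + Complex.I * (Real.sqrt 3 : ℂ)) / 2 * htr
      + (Real.sqrt 3 : ℂ) ^ 2 / 6 * hI - h3 / 6
  have h11 : A j 1 1 = (3 - Complex.I * (Real.sqrt 3 : ℂ)) / 6 := by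
    linear_combination htr - h00
  refine ⟨h00, h11, ?_⟩
  rw [h00, h11] at hdet
  linear_combination -hdet - (Real.sqrt 3 : ℂ) ^ 2 / 36 * hI + h3 / 36

/-- Three matrices besides `0` and `1` are impossible: with the first in diagonal form, the ratio
`t` of corresponding off-diagonal entries of the other two satisfies `t + t⁻¹ = 1 / 2`, while
exchanging those two forces `t ^ 2 = 1`. -/
theorem eq_of_dim_two (h : IsAffineFamily A b c) {i j k : κ} (hib : i ≠ b) (hic : i ≠ c)
    (hjb : j ≠ b) (hjc : j ≠ c) (hji : j ≠ i) (hkb : k ≠ b) (hkc : k ≠ c) (hki : k ≠ i) :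
    j = k := by
  classical
  by_contra hjk
  obtain ⟨S, hS⟩ := h.exists_diagonal hib hic
  replace h := h.conj S
  generalize hB : (fun i => (S⁻¹).val * A i * S.val) = B at h
  have hBi : B i = tildeSigma5BlockFour := by rw [← hS, ← hB]
  obtain ⟨hj0, hj1, hj⟩ := h.entries hib hic hjb hjc hji hBi
  obtain ⟨hk0, hk1, hk⟩ := h.entries hib hic hkb hkc hki hBi
  have hadj := h.trace_adjugate_mul hjb hjc hkb hkc (Ne.symm hjk)
  have hdet := h.det_eq_one hjb hjc
  rw [Matrix.adjugate_fin_two, Matrix.trace_fin_two] at hadj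
  simp [Matrix.mul_apply, Fin.sum_univ_two] at hadj
  rw [hk0, hk1, ← hj0, ← hj1] at hadj
  rw [Matrix.det_fin_two] at hdet
  obtain ⟨q, hq, H⟩ := h.exists_conj (σ := Equiv.swap j k)
    (Equiv.swap_apply_of_ne_of_ne hjb.symm hkb.symm)
    (Equiv.swap_apply_of_ne_of_ne hjc.symm hkc.symm)
  have e := H i
  rw [Equiv.swap_apply_of_ne_of_ne hji.symm hki.symm, hBi] at e
  have hdiag : tildeSigma5BlockFour = diagonal ![zeta6, zeta6⁻¹] := by
    rw [tildeSigma5BlockFour]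
    ext x y
    fin_cases x <;> fin_cases y <;> simp
  rw [hdiag] at e
  have hqd := eq_diagonal_of_commute injective_zeta6 e
  have e₁ := H j
  have e₂ := H k
  rw [Equiv.swap_apply_left] at e₁
  rw [Equiv.swap_apply_right] at e₂
  rw [hqd] at e₁ e₂ hq
  have f₁ := congrFun (congrFun e₁ 0) 1
  have f₂ := congrFun (congrFun e₂ 0) 1
  rw [Matrix.diagonal_mul, Matrix.mul_diagonal] at f₁ f₂
  have hu := (Matrix.isUnit_iff_isUnit_det _).1 hq
  rw [Matrix.det_diagonal, Fin.prod_univ_two] at hu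
  have hu0 := left_ne_zero_of_mul hu.ne_zero
  generalize q.diag 0 = u at *
  generalize q.diag 1 = w at *
  have hjne : B j 0 1 ≠ 0 := by
    intro h0
    rw [h0, zero_mul] at hj
    norm_num at hj
  have hsq : (u * (B j 0 1)) ^ 2 = (u * (B k 0 1)) ^ 2 := by
    have : u * B j 0 1 * (u * B j 0 1 ) = u * B k 0 1 * (u * B k 0 1) := by
      linear_combination (u * B j 0 1) * f₁ - (u * B k 0 1) * f₂
    linear_combination this
  rw [mul_pow, mul_pow] at hsq
  have hsq' := mul_left_cancel₀ (pow_ne_zero 2 hu0) hsq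
  have hcross : B j 0 1 * B k 1 0 + B k 0 1 * B j 1 0 = -1 / 3 := by
    linear_combination -hadj + 2 * hdet + 2 * hj
  rcases sq_eq_sq_iff_eq_or_eq_neg.1 hsq' with hjk' | hjk'
  · have h1 : B j 0 1 * B k 1 0 = -2 / 3 := by rw [hjk', hk]
    have h2 : B k 0 1 * B j 1 0 = -2 / 3 := by rw [← hjk', hj]
    rw [h1, h2] at hcross
    norm_num at hcross
  · have h1 : B j 0 1 * B k 1 0 = 2 / 3 := by rw [hjk', neg_mul, hk]; norm_num
    have h2 : B k 0 1 * B j 1 0 = 2 / 3 := by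
      rw [eq_comm, neg_eq_iff_eq_neg] at hjk'
      rw [hjk', neg_mul, hj]; norm_num
    rw [h1, h2] at hcross
    norm_num at hcross

/-- Two matrices besides `0` and `1` are simultaneously conjugate to the blocks `A₄` and `A₅`. -/
theorem exists_normal_form (h : IsAffineFamily A b c) {i j : κ} (hib : i ≠ b) (hic : i ≠ c)
    (hjb : j ≠ b) (hjc : j ≠ c) (hji : j ≠ i) :
    ∃ S : (Matrix (Fin 2) (Fin 2) ℂ)ˣ, (S⁻¹).val * A i * S.val = tildeSigma5BlockFour ∧
      (S⁻¹).val * A j * S.val = tildeSigma5BlockFive := by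
  obtain ⟨S, hS⟩ := h.exists_diagonal hib hic
  obtain ⟨h0, h1, h01⟩ := (h.conj S).entries hib hic hjb hjc hji hS
  set B := (S⁻¹).val * A j * S.val with hB
  set r : ℂ := (Real.sqrt 2 : ℂ) * Complex.I / (Real.sqrt 3 : ℂ) with hr
  have hrr : r * r = -2 / 3 := by
    have h3 : (Real.sqrt 3 : ℂ) ^ 2 = 3 := by
      rw [← Complex.ofReal_pow, Real.sq_sqrt (by norm_num)]
      norm_num
    have h2 : (Real.sqrt 2 : ℂ) ^ 2 = 2 := by
      rw [← Complex.ofReal_pow, Real.sq_sqrt (by norm_num)]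
      norm_num
    rw [hr, div_mul_div_comm, ← pow_two, ← pow_two, h3, mul_pow, h2, Complex.I_sq]
    norm_num
  have hr0 : r ≠ 0 := by
    intro h0
    rw [h0] at hrr
    norm_num at hrr
  have hB0 : B 0 1 ≠ 0 := by
    intro h0
    rw [h0, zero_mul] at h01
    norm_num at h01
  -- conjugation by `diag(B₀₁, r)` turns the off-diagonal entry `B₀₁` into `r`
  let D : (Matrix (Fin 2) (Fin 2) ℂ)ˣ :=
    ⟨!![B 0 1, 0; 0, r], !![(B 0 1)⁻¹, 0; 0, r⁻¹],
      by ext x y; fin_cases x <;> fin_cases y <;> simp [Matrix.mul_apply, hB0, hr0],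
      by ext x y; fin_cases x <;> fin_cases y <;> simp [Matrix.mul_apply, hB0, hr0]⟩
  have hD : D.val = !![B 0 1, 0; 0, r] := rfl
  have hconj : ∀ X Y : Matrix (Fin 2) (Fin 2) ℂ, (S⁻¹).val * X * S.val * D.val = D.val * Y →
      ((S * D)⁻¹).val * X * (S * D).val = Y := by
    intro X Y hXY
    rw [_root_.mul_inv_rev, Units.val_mul, Units.val_mul, ← Units.inv_mul_cancel_left D Y, ← hXY]
    simp only [mul_assoc]
  refine ⟨S * D, hconj _ _ ?_, hconj _ _ ?_⟩
  · rw [hS, hD, tildeSigma5BlockFour]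
    ext x y
    fin_cases x <;> fin_cases y <;> simp [Matrix.mul_apply, mul_comm]
  · rw [← hB, hD, tildeSigma5BlockFive, ← hr]
    ext x y
    fin_cases x <;> fin_cases y <;>
      simp [Matrix.mul_apply, Fin.sum_univ_two, h0, h1, mul_comm]
    linear_combination h01 - hrr

end IsAffineFamily

/-! ### The complementary case -/

/-- An affine family of at least `2 * d` matrices of size `d` consists of `0` and `1` in dimension
one, or of four matrices in dimension two. -/
theorem IsAffineFamily.dim_card_cases {κ : Type} [Fintype κ] {d n : ℕ}
    {A : κ → Matrix (Fin d) (Fin d) ℂ} {b c : κ} (ih : CardBoundBelow n)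
    (h : IsAffineFamily A b c) (hdn : d < n) (hd : 0 < d) (hcard : 2 * d ≤ Fintype.card κ) :
    (d = 1 ∧ Fintype.card κ = 2) ∨ (d = 2 ∧ Fintype.card κ = 4) := by
  classical
  have hc := h.card_others
  have hd3 : d ≤ 3 := by
    by_contra! h3
    have := h.card_le ih hdn hd (by omega)
    omega
  interval_cases d
  · left
    refine ⟨rfl, ?_⟩
    by_contra hne
    have : 0 < Fintype.card {i // i ≠ b ∧ i ≠ c} := by omega
    obtain ⟨i, hib, hic⟩ := Fintype.card_pos_iff.1 this
    exact h.dim_ne_one hib hic rfl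
  · right
    refine ⟨rfl, ?_⟩
    by_contra hne
    have : 2 < Fintype.card {i // i ≠ b ∧ i ≠ c} := by omega
    obtain ⟨i, j, k, hij, hik, hjk⟩ := Fintype.two_lt_card_iff.1 this
    refine hjk (Subtype.ext ?_)
    exact h.eq_of_dim_two i.2.1 i.2.2 j.2.1 j.2.2 (Subtype.coe_injective.ne hij.symm)
      k.2.1 k.2.2 (Subtype.coe_injective.ne hik.symm)
  · exfalso
    obtain ⟨f⟩ : Nonempty (Fin 4 ↪ {i // i ≠ b ∧ i ≠ c}) :=
      Function.Embedding.nonempty_of_card_le (by rw [Fintype.card_fin]; omega)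
    have hf : ∀ x y, x ≠ y → (f x : κ) ≠ f y := fun x y hxy =>
      Subtype.coe_injective.ne (f.injective.ne hxy)
    exact h.dim_ne_three (f 0).2.1 (f 0).2.2
      ⟨(f 1).2.1, (f 1).2.2, hf 1 0 (by decide)⟩ ⟨(f 2).2.1, (f 2).2.2, hf 2 0 (by decide)⟩
      ⟨(f 3).2.1, (f 3).2.2, hf 3 0 (by decide)⟩ (hf 1 2 (by decide)) (hf 1 3 (by decide))
      (hf 2 3 (by decide)) rfl

namespace IsGraphChart

variable {ι V V' : Type} [AddCommGroup V] [Module ℂ V] [AddCommGroup V'] [Module ℂ V'] {d : ℕ}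
  {W : ι → Submodule ℂ V} {W' : ι → Submodule ℂ V'} {a : ι}
  {e : ((Fin d → ℂ) × (Fin d → ℂ)) ≃ₗ[ℂ] V} {e' : ((Fin d → ℂ) × (Fin d → ℂ)) ≃ₗ[ℂ] V'}
  {A A' : ι → Matrix (Fin d) (Fin d) ℂ}

theorem isAffineFamily (h : IsGraphChart W a e A) (hW : IsTotallySymmetricArrangement W)
    (hc : ∀ i j, i ≠ j → IsCompl (W i) (W j)) {b c : ι} (hb : b ≠ a) (hca : c ≠ a) (hbc : b ≠ c)
    (h0 : A b = 0) (h1 : A c = 1) :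
    IsAffineFamily (fun i : {i // i ≠ a} => A i) ⟨b, hb⟩ ⟨c, hca⟩ where
  ne h := hbc (congrArg Subtype.val h)
  zero := h0
  one := h1
  isUnit_sub i j hij := h.isUnit_sub hc i.2 j.2 (Subtype.coe_injective.ne hij)
  affine := h.exists_affine hW

theorem arrangementIso (h : IsGraphChart W a e A) (h' : IsGraphChart W' a e' A')
    (S : (Matrix (Fin d) (Fin d) ℂ)ˣ)
    (hS : ∀ i, i ≠ a → (S⁻¹).val * A i * S.val = A' i) : ArrangementIso W W' := by
  let s : (Fin d → ℂ) ≃ₗ[ℂ] (Fin d → ℂ) := Matrix.toLin'OfInv S.mul_inv S.inv_mul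
  have hs : ∀ x, s x = (S⁻¹).val *ᵥ x := fun x => Matrix.toLin'_apply _ x
  refine ⟨(e.symm.trans (LinearEquiv.prodCongr s s)).trans e', fun i => ?_⟩
  rw [Submodule.map_linearEquiv_eq_iff]
  intro v
  obtain ⟨⟨x, y⟩, rfl⟩ := e.surjective v
  have hT : ((e.symm.trans (LinearEquiv.prodCongr s s)).trans e') (e (x, y)) = e' (s x, s y) := by
    simp
  rw [hT]
  rcases eq_or_ne i a with rfl | hi
  · rw [h.mem_base, h'.mem_base, LinearEquiv.map_eq_zero_iff]
  · rw [h.mem_graph i hi, h'.mem_graph i hi, ← hS i hi, hs y, Matrix.mulVec_mulVec, mul_assoc,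
      Units.mul_inv, mul_one, ← Matrix.mulVec_mulVec, ← hs, s.injective.eq_iff]

end IsGraphChart

/-- Large symmetric arrangements of pairwise complementary subspaces consist of three lines in the
plane or five planes in a four-dimensional space. -/
theorem complementary_cases {ι V : Type} [Fintype ι] [AddCommGroup V] [Module ℂ V]
    [FiniteDimensional ℂ V] (ih : CardBoundBelow (finrank ℂ V)) {W : ι → Submodule ℂ V}
    (hW : IsTotallySymmetricArrangement W) (hnd : ¬ IsDegenerateArrangement W)
    (hcard : finrank ℂ V + 1 ≤ Fintype.card ι) (hc : ∀ i j, i ≠ j → IsCompl (W i) (W j)) :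
    (finrank ℂ V = 2 ∧ Fintype.card ι = 3 ∧ ∀ i, finrank ℂ (W i) = 1) ∨
      (finrank ℂ V = 4 ∧ Fintype.card ι = 5) := by
  classical
  obtain ⟨d, hd⟩ := hW.1
  have hdim : finrank ℂ V = d + d := by
    have : 1 < Fintype.card ι := by
      rw [← not_le, Fintype.card_le_one_iff]
      exact fun h => hnd (isDegenerateArrangement_iff.2 fun i j => by rw [h i j])
    obtain ⟨i, j, hij⟩ := Fintype.one_lt_card_iff.1 this
    rw [← Submodule.finrank_add_eq_of_isCompl (hc i j hij), hd, hd]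
  have hdpos : 0 < d := by
    by_contra h0
    refine hnd ⟨⊥, fun i => Submodule.finrank_eq_zero.1 ?_⟩
    rw [hd]
    omega
  obtain ⟨a, b, c, hab, hac, hbc⟩ := Fintype.two_lt_card_iff.1
    (show 2 < Fintype.card ι by omega)
  obtain ⟨e, A, h, h0, h1⟩ := exists_isGraphChart hc hd hab.symm hac.symm hbc
  have hκ : Fintype.card {i // i ≠ a} = Fintype.card ι - 1 := by
    simp [Fintype.card_subtype_compl]
  rcases (h.isAffineFamily hW hc hab.symm hac.symm hbc h0 h1).dim_card_cases ih (by omega) hdpos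
    (by omega) with ⟨rfl, h2⟩ | ⟨rfl, h4⟩
  · exact .inl ⟨hdim, by omega, hd⟩
  · exact .inr ⟨hdim, by omega⟩

/-! ### The bound and the extremal arrangements -/

/-- A nondegenerate symmetric arrangement has at most `dim V + 1` members. -/
theorem cardBoundBelow (n : ℕ) : CardBoundBelow n := by
  induction n with
  | zero => exact fun ι V _ _ _ _ W hlt => absurd hlt (Nat.not_lt_zero _)
  | succ n ih =>
    intro ι V _ _ _ _ W hlt hW hnd
    have ih' : CardBoundBelow (finrank ℂ V) := fun κ U _ _ _ _ X hX =>
      ih κ U X (by omega)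
    by_contra! hcard
    rcases lines_or_hyperplanes_or_isCompl ih' hW hnd (by omega) with h | h | h
    · omega
    · omega
    · rcases complementary_cases ih' hW hnd (by omega) h with h | h <;> omega

/-- Coordinates on `ℂ⁴` splitting off the first two entries. -/
def finTwoProdEquiv : ((Fin 2 → ℂ) × (Fin 2 → ℂ)) ≃ₗ[ℂ] (Fin 4 → ℂ) where
  toFun z := ![z.1 0, z.1 1, z.2 0, z.2 1]
  invFun v := (![v 0, v 1], ![v 2, v 3])
  map_add' z w := by ext i; fin_cases i <;> rfl
  map_smul' t z := by ext i; fin_cases i <;> rfl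
  left_inv z := by
    refine Prod.ext ?_ ?_ <;> ext i <;> fin_cases i <;> rfl
  right_inv v := by ext i; fin_cases i <;> rfl

theorem mulVec_fin_two {m : ℕ} (M : Matrix (Fin m) (Fin 2) ℂ) (x : Fin 2 → ℂ) (k : Fin m) :
    (M *ᵥ x) k = M k 0 * x 0 + M k 1 * x 1 := by
  rw [Matrix.mulVec, dotProduct, Fin.sum_univ_two]

theorem mulVec_four_two (p q r s t u v w : ℂ) (x : Fin 2 → ℂ) :
    !![p, q; r, s; t, u; v, w] *ᵥ x = ![p * x 0 + q * x 1, r * x 0 + s * x 1, t * x 0 + u * x 1,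
      v * x 0 + w * x 1] := by
  ext i
  fin_cases i <;> exact mulVec_fin_two _ _ _

/-- The blocks of the `Σ̃₅` arrangement are its matrices in the standard coordinates. -/
theorem isGraphChart_tildeSigma5 : IsGraphChart tildeSigma5Arrangement 0 finTwoProdEquiv
    ![0, 0, 1, tildeSigma5BlockFour, tildeSigma5BlockFive] := by
  have key : ∀ (i : Fin 5) (x y : Fin 2 → ℂ), finTwoProdEquiv (x, y) ∈ tildeSigma5Arrangement i ↔
      ∃ u, tildeSigma5Matrix i *ᵥ u = ![x 0, x 1, y 0, y 1] := fun i x y => Iff.rfl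
  have graph : ∀ (N : Matrix (Fin 2) (Fin 2) ℂ) (x y : Fin 2 → ℂ),
      (∃ u, !![N 0 0, N 0 1; N 1 0, N 1 1; 1, 0; 0, 1] *ᵥ u = ![x 0, x 1, y 0, y 1]) ↔
        x = N *ᵥ y := by
    intro N x y
    simp_rw [mulVec_four_two]
    constructor
    · rintro ⟨u, hu⟩
      have h0 : N 0 0 * u 0 + N 0 1 * u 1 = x 0 := congrFun hu 0
      have h1 : N 1 0 * u 0 + N 1 1 * u 1 = x 1 := congrFun hu 1
      have h2 : 1 * u 0 + 0 * u 1 = y 0 := congrFun hu 2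
      have h3 : 0 * u 0 + 1 * u 1 = y 1 := congrFun hu 3
      refine funext (Fin.forall_fin_two.2 ⟨?_, ?_⟩)
      · rw [mulVec_fin_two, ← h0, ← h2, ← h3]
        ring
      · rw [mulVec_fin_two, ← h1, ← h2, ← h3]
        ring
    · rintro rfl
      refine ⟨y, ?_⟩
      rw [mulVec_fin_two, mulVec_fin_two, one_mul, zero_mul, add_zero, zero_mul, one_mul, zero_add]
  refine ⟨fun x y => ?_, fun i hi x y => ?_⟩
  · rw [key]
    change (∃ u, !![1, 0; 0, 1; 0, 0; 0, 0] *ᵥ u = _) ↔ _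
    simp_rw [mulVec_four_two]
    constructor
    · rintro ⟨u, hu⟩
      have h2 : 0 * u 0 + 0 * u 1 = y 0 := congrFun hu 2
      have h3 : 0 * u 0 + 0 * u 1 = y 1 := congrFun hu 3
      refine funext (Fin.forall_fin_two.2 ⟨?_, ?_⟩)
      · rw [← h2, Pi.zero_apply]
        ring
      · rw [← h3, Pi.zero_apply]
        ring
    · rintro rfl
      refine ⟨x, ?_⟩
      rw [one_mul, zero_mul, zero_mul, zero_add, one_mul, add_zero, add_zero]
      rfl
  · rw [key]
    fin_cases i
    · exact absurd rfl hi
    · exact graph 0 x y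
    · exact graph 1 x y
    · exact graph tildeSigma5BlockFour x y
    · exact graph tildeSigma5BlockFive x y

theorem arrangementIso_tildeSigma5Arrangement {V : Type} [AddCommGroup V] [Module ℂ V]
    [FiniteDimensional ℂ V] {W : Fin 5 → Submodule ℂ V} (hW : IsTotallySymmetricArrangement W)
    (hc : ∀ i j, i ≠ j → IsCompl (W i) (W j)) (hV : finrank ℂ V = 4) :
    ArrangementIso W tildeSigma5Arrangement := by
  have hd : ∀ i, finrank ℂ (W i) = 2 := by
    obtain ⟨d, hd⟩ := hW.1
    have := Submodule.finrank_add_eq_of_isCompl (hc 0 1 (by decide))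
    rw [hd, hd, hV] at this
    intro i
    rw [hd]
    omega
  obtain ⟨e, A, h, h1, h2⟩ := exists_isGraphChart (a := 0) (b := 1) (c := 2) hc hd (by decide)
    (by decide) (by decide)
  obtain ⟨S, hS₃, hS₄⟩ := (h.isAffineFamily hW hc (by decide) (by decide) (by decide) h1
    h2).exists_normal_form (i := ⟨3, by decide⟩) (j := ⟨4, by decide⟩) (by decide) (by decide)
    (by decide) (by decide) (by decide)
  refine h.arrangementIso isGraphChart_tildeSigma5 S fun i hi => ?_
  fin_cases i
  · exact absurd rfl hi
  · simp [h1]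
  · simp [h2]
  · exact hS₃
  · exact hS₄

theorem mainTheorem5 (n k : ℕ) (W : Fin k → Submodule ℂ (Fin n → ℂ))
    (hW : IsTotallySymmetricArrangement W) (hnd : ¬ IsDegenerateArrangement W) :
    k ≤ n + 1 ∧
      ∀ h : k = n + 1,
        ArrangementIso (fun i : Fin (n + 1) => W (Fin.cast h.symm i)) (simplexArrangement n) ∨
        ArrangementIso (fun i : Fin (n + 1) => W (Fin.cast h.symm i))
          (dualArrangement (simplexArrangement n)) ∨
        ∃ h5 : k = 5,
          ArrangementIso (fun i : Fin 5 => W (Fin.cast h5.symm i)) tildeSigma5Arrangement := by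
  have hn : finrank ℂ (Fin n → ℂ) = n := Module.finrank_fin_fun ℂ
  have ih := cardBoundBelow (finrank ℂ (Fin n → ℂ))
  refine ⟨?_, ?_⟩
  · have := cardBoundBelow (n + 1) (Fin k) (Fin n → ℂ) W (by omega) hW hnd
    rwa [hn, Fintype.card_fin] at this
  rintro rfl
  have hcard : finrank ℂ (Fin n → ℂ) + 1 ≤ Fintype.card (Fin (n + 1)) := by
    rw [hn, Fintype.card_fin]
  have hlines : (∀ i, finrank ℂ (W i) = 1) → ArrangementIso W (simplexArrangement n) := fun h =>
    arrangementIso_simplexArrangement hn hW h (iSup_eq_top_of_card ih hW hnd hcard)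
  rcases lines_or_hyperplanes_or_isCompl ih hW hnd hcard with h | h | hc
  · exact .inl (hlines h.2)
  · have hdual : finrank ℂ (Dual ℂ (Fin n → ℂ)) = finrank ℂ (Fin n → ℂ) :=
      Subspace.dual_finrank_eq
    refine .inr (.inl (ArrangementIso.of_dual ?_))
    refine arrangementIso_simplexArrangement (hdual.trans hn) hW.dual (fun i => ?_)
      (iSup_eq_top_of_card (by rwa [hdual]) hW.dual (not_isDegenerateArrangement_dual hnd)
        (by rwa [hdual]))
    have h1 := Subspace.finrank_add_finrank_dualAnnihilator_eq (W i)
    have h2 := h.2 i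
    change finrank ℂ (W i).dualAnnihilator = 1
    omega
  · rcases complementary_cases ih hW hnd hcard hc with h | h
    · exact .inl (hlines h.2.2)
    · obtain rfl : n = 4 := hn.symm.trans h.1
      exact .inr (.inr ⟨rfl, arrangementIso_tildeSigma5Arrangement hW hc h.1⟩)

end
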